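/- \textbf{Theorem (Minimax upper bounds for the degree-corrected block model).} \emph{Parameter space.} For $n\ge 1$, $k\ge 2$, $\theta\in(0,\infty)^n$, $0\le q<p$, $\beta\ge 1$ and $\delta\in\mathbb R$, let $\mathcal P_n(\theta,p,q,k,\beta;\delta)$ be the set of matrices $P\in[0,1]^{n\times n}$ for which there are a label vector $z\in[k]^n$ and a symmetric $B\in\mathbb R^{k\times k}$ such that, with $n_u=|\{i:z(i)=u\}|$, \begin{itemize} \item $P_{ii}=0$ for all $i$ and $P_{ij}=\theta_i\theta_jB_{z(i)z(j)}$ for all $i\ne j$; \item $\frac1{n_u}\sum_{i:z(i)=u}\theta_i\in[1-\delta,1+\delta]$ for all $u\in[k]$; \item $\max_{u\ne v}B_{uv}\le q<p\le\min_uB_{uu}$; \item $\frac n{\beta k}-1\le n_u\le\frac{\beta n}k+1$ for all $u\in[k]$. \end{itemize} Such a $z$ is called a label vector of $P$, and the label vectors of the elements of $\mathcal P_n$ are called admissible. Given $P\in\mathcal P_n$, one observes a symmetric matrix $A\in\{0,1\}^{n\times n}$ with zero diagonal whose entries $A_{ij}$, $i<j$, are independent with $A_{ij}\sim\mathrm{Bern}(P_{ij})$;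 $\mathbb E$ is expectation under this law. \emph{Loss, estimator, information.} For $z_1,z_2\in[k]^n$ let $\ell(z_1,z_2)=\frac1n\min_\pi|\{i:z_1(i)\neq\pi(z_2(i))\}|$, the minimum being over all permutations $\pi$ of $[k]$. Let $\hat z=\hat z(A)$ be a maximizer, over all admissible $z'$, of $$\prod_{1\le i<j\le n}\Big[(\theta_i\theta_jp)^{A_{ij}}(1-\theta_i\theta_jp)^{1-A_{ij}}\mathbf 1_{\{z'(i)=z'(j)\}}+(\theta_i\theta_jq)^{A_{ij}}(1-\theta_i\theta_jq)^{1-A_{ij}}\mathbf 1_{\{z'(i)\ne z'(j)\}}\Big],$$ with ties broken arbitrarily. Define $I$ by $$e^{-I}=\begin{cases}\frac1n\sum_{i=1}^n\exp\big(-\theta_i\frac n2(\sqrt p-\sqrt q)^2\big),&k=2,\\ \frac1n\sum_{i=1}^n\exp\big(-\theta_i\frac n{\beta k}(\sqrt p-\sqrt q)^2\big),&k\ge3.\end{cases}$$ \emph{Claim.} Let $\beta\ge1$ be fixed and consider a sequence of such parameter spaces in which $\theta,p,q,k,\delta$ may depend on $n$, such that, as $n\to\infty$, \begin{itemize} \item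 $\delta\to0$; $0\le q<p$ for all large $n$; and, for all large $n$, $\theta_i\theta_jq<1$ for all $i\ne j$ (so that the likelihood above is that of a genuine model); \item $I\to\infty$; $\|\theta\|_\infty=o(n/k)$; $\log k=o(\min(I,\log n))$; and there is a constant $c>0$ with $\min_i\theta_i\ge c$ for all $n$; \item for all large $n$, if $k\ge3$ then $\beta<\sqrt{5/3}$. \end{itemize} Then $$\limsup_{n\to\infty}\frac1I\log\Big(\sup\,\mathbb E\,\ell(\hat z,z)\Big)\le-1,$$ where the supremum is over all $P\in\mathcal P_n(\theta,p,q,k,\beta;\delta)$ and all label vectors $z$ of $P$, and where $\log 0=-\infty$ and the supremum over the empty set is $0$. -/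

import Mathlib

open Filter Topology MeasureTheory ProbabilityTheory

namespace DCBM

/-- The size `n_u(z)` of the `u`-th community of the label vector `z`. -/
def commSize {n k : ℕ} (z : Fin n → Fin k) (u : Fin k) : ℕ :=
  (Finset.univ.filter fun i => z i = u).card

/-- `P` belongs to the parameter space `𝒫_n(θ,p,q,k,β;δ)`, with label vector `z` and
connectivity matrix `B` as witnesses. -/
structure IsRealizedBy {n k : ℕ} (θ : Fin n → ℝ) (p q β δ : ℝ)
    (P : Matrix (Fin n) (Fin n) unitInterval) (z : Fin n → Fin k)
    (B : Matrix (Fin k) (Fin k) ℝ) : Prop where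
  symm : B.IsSymm
  diag : ∀ i, (P i i : ℝ) = 0
  prob : ∀ i j, i ≠ j → (P i j : ℝ) = θ i * θ j * B (z i) (z j)
  normalization : ∀ u,
    (∑ i ∈ Finset.univ.filter (fun i => z i = u), θ i) / (commSize z u : ℝ)
      ∈ Set.Icc (1 - δ) (1 + δ)
  between : ∀ u v, u ≠ v → B u v ≤ q
  lt : q < p
  within : ∀ u, p ≤ B u u
  size_lower : ∀ u, (n : ℝ) / (β * k) - 1 ≤ commSize z u
  size_upper : ∀ u, (commSize z u : ℝ) ≤ β * n / k + 1

/-- `P` lies in the parameter space and `z` is a label vector of `P`. -/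
def HasLabels {n k : ℕ} (θ : Fin n → ℝ) (p q β δ : ℝ)
    (P : Matrix (Fin n) (Fin n) unitInterval) (z : Fin n → Fin k) : Prop :=
  ∃ B : Matrix (Fin k) (Fin k) ℝ, IsRealizedBy θ p q β δ P z B

/-- The label vectors occurring in the parameter space. -/
def admissible {n : ℕ} (k : ℕ) (θ : Fin n → ℝ) (p q β δ : ℝ) : Set (Fin n → Fin k) :=
  {z | ∃ P, HasLabels θ p q β δ P z}

/-- The unordered pairs of distinct nodes, written as `(i, j)` with `i < j`. -/
abbrev Pair (n : ℕ) : Type := {e : Fin n × Fin n // e.1 < e.2}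

/-- The symmetric `0`-`1` adjacency matrix with zero diagonal and edge indicators `ω`. -/
def adjacency {n : ℕ} (ω : Pair n → Bool) : Matrix (Fin n) (Fin n) ℕ := fun i j =>
  if h : i < j then (ω ⟨(i, j), h⟩).toNat
  else if h : j < i then (ω ⟨(j, i), h⟩).toNat
  else 0

/-- The law of the edge indicators: independent, with `A_ij ∼ Bern(P_ij)` for `i < j`. -/
noncomputable def edgeLaw {n : ℕ} (P : Matrix (Fin n) (Fin n) unitInterval) :
    Measure (Pair n → Bool) :=
  Measure.pi fun e => bernoulliMeasure true false (P e.1.1 e.1.2)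

/-- The misclassification proportion
`ℓ(z₁, z₂) = n⁻¹ min_π H(z₁, π(z₂))`, with `π` over all permutations of the labels. -/
noncomputable def loss {n k : ℕ} (z₁ z₂ : Fin n → Fin k) : ℝ :=
  (1 / (n : ℝ)) * ⨅ π : Equiv.Perm (Fin k), (hammingDist z₁ (π ∘ z₂) : ℝ)

/-- The objective function: the likelihood of the label vector `z` at the adjacency matrix `A`
in the model with `B_uu = p` and `B_uv = q` for `u ≠ v`. -/
noncomputable def likelihood {n k : ℕ} (θ : Fin n → ℝ) (p q : ℝ)
    (A : Matrix (Fin n) (Fin n) ℕ) (z : Fin n → Fin k) : ℝ :=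
  ∏ e : Pair n,
    let i := e.1.1
    let j := e.1.2
    if z i = z j then (θ i * θ j * p) ^ A i j * (1 - θ i * θ j * p) ^ (1 - A i j)
    else (θ i * θ j * q) ^ A i j * (1 - θ i * θ j * q) ^ (1 - A i j)

/-- `zhat` maximizes the likelihood over the admissible label vectors, for every adjacency matrix,
with ties broken in any way (no condition if there is no admissible label vector). -/
def IsMLE {n k : ℕ} (θ : Fin n → ℝ) (p q β δ : ℝ)
    (zhat : Matrix (Fin n) (Fin n) ℕ → Fin n → Fin k) : Prop :=
  (admissible k θ p q β δ).Nonempty → ∀ ω : Pair n → Bool,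
    zhat (adjacency ω) ∈ admissible k θ p q β δ ∧
    ∀ z ∈ admissible k θ p q β δ,
      likelihood θ p q (adjacency ω) z ≤ likelihood θ p q (adjacency ω) (zhat (adjacency ω))

/-- The expected loss `𝔼 ℓ(zhat, z)` under edge probabilities `P`. -/
noncomputable def risk {n k : ℕ} (zhat : Matrix (Fin n) (Fin n) ℕ → Fin n → Fin k)
    (P : Matrix (Fin n) (Fin n) unitInterval) (z : Fin n → Fin k) : ℝ :=
  ∫ ω, loss (zhat (adjacency ω)) z ∂(edgeLaw P)

/-- The worst-case risk over the parameter space, as an element of `[0, ∞]`. -/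
noncomputable def worstRisk {n k : ℕ} (θ : Fin n → ℝ) (p q β δ : ℝ)
    (zhat : Matrix (Fin n) (Fin n) ℕ → Fin n → Fin k) : ENNReal :=
  ⨆ (P : Matrix (Fin n) (Fin n) unitInterval) (z : Fin n → Fin k)
    (_ : HasLabels θ p q β δ P z), ENNReal.ofReal (risk zhat P z)

/-- The quantity `I`, defined through `exp(-I)`. -/
noncomputable def info {n : ℕ} (k : ℕ) (θ : Fin n → ℝ) (p q β : ℝ) : ℝ :=
  -Real.log (if k = 2
    then (1 / (n : ℝ)) * ∑ i, Real.exp (-(θ i * ((n : ℝ) / 2) * (√p - √q) ^ 2))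
    else (1 / (n : ℝ)) * ∑ i, Real.exp (-(θ i * ((n : ℝ) / (β * k)) * (√p - √q) ^ 2)))

end DCBM

/-!
The loss of the maximum likelihood estimator is controlled by a union bound over labelings `s`, in
which three things have to be balanced: the probability that `s` is at least as likely as the truth
`z`, the number of labelings, and the fact that the nodes have different weights `θ i`.

*One labeling.* The Chernoff bound with exponent `1/2` shows that `s` beats `z` with probability at
most `exp (-(√p - √q) ^ 2 / 2 * discordance θ z s)`, where the discordance is the total weight
`θ i * θ j` of the pairs on which `z` and `s` disagree as to whether `i` and `j` share a community
(`prob_likelihood_le_exp_discordance`). The true edge probabilities need not equal `θ i * θ j * p`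
or `θ i * θ j * q`, but they deviate from these values in the favourable direction only.

*Discordance and errors.* Let `g` be the weight of the nodes misplaced by `s` relative to a
relabeling of `z`, and let `M = effSize n k β`. Each misplaced node disagrees with nearly all of the
community that it left and of the one that it entered, so the discordance is about `2 * M * g` if
`g` is small compared with `M` (`errorMass_mul_le_discordance`). In general, for the best
relabeling, it is at least a constant times `M * g` (`exists_perm_errorMass_le_discordance`): link
two labels if their overlap exceeds half of each community. This is a partial matching, it extends
to a permutation of the labels, and each node outside of the linked overlaps has discordances of
weight at least half of a community.

*Union bound.* Both estimates are products over the misplaced nodes, of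
`exp (-(1 - η) * M * (√p - √q) ^ 2 * θ i)` for small `g` and of a similar factor with a worse
exponent for large `g`; in the second case half of the exponent can be spared for a prefactor that
is exponentially small in `M * I`. The sum over all labelings of such a product factorizes, and
`sum_mul_hammingDist_le` turns it into a bound on the expected number of errors. Jensen's
inequality for `x ↦ x ^ t` compares `∑ i, exp (-t * M * (√p - √q) ^ 2 * θ i)` with
`n * exp (-t * I)`. As `log k = o(I)` and `M → ∞`, the factors `k` are absorbed and the labelings
with large `g` become negligible, which leaves `exp (-(1 - 3 * η) * I)` (`risk_le_exp_info`).
-/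

namespace DCBM

/-! ### Chernoff bound for the comparison of two likelihoods -/

/-- The mass that the Bernoulli law with success probability `a` gives to `b`. -/
def bern (a : ℝ) (b : Bool) : ℝ := if b then a else 1 - a

lemma bern_nonneg {a : ℝ} (h0 : 0 ≤ a) (h1 : a ≤ 1) (b : Bool) : 0 ≤ bern a b := by
  cases b <;> simp [bern, h0, h1]

lemma affinity_le_exp {x y : ℝ} (hx0 : 0 ≤ x) (hx1 : x ≤ 1) (hy0 : 0 ≤ y) (hy1 : y ≤ 1) :
    √(x * y) + √((1 - x) * (1 - y)) ≤ Real.exp (-((√x - √y) ^ 2 / 2)) := by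
  have h1 : √((1 - x) * (1 - y)) ≤ 1 - (x + y) / 2 := by
    rw [Real.sqrt_le_left (by linarith)]
    nlinarith [sq_nonneg (x - y)]
  have h2 : (√x - √y) ^ 2 = x + y - 2 * √(x * y) := by
    rw [Real.sqrt_mul hx0]
    nlinarith [Real.sq_sqrt hx0, Real.sq_sqrt hy0]
  have h3 := Real.add_one_le_exp (-((√x - √y) ^ 2 / 2))
  linarith

lemma mul_sqrt_div {x y : ℝ} (hx : 0 < x) : x * √(y / x) = √(x * y) := by
  have : x * y = x ^ 2 * (y / x) := by field_simp
  rw [this, Real.sqrt_mul (sq_nonneg x), Real.sqrt_sq hx.le]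

/-- Moving the success probability `P` away from `y`, beyond `x`, only decreases the moment of
order `1/2` of the likelihood ratio of `y` to `x`. -/
lemma sqrt_ratio_le_affinity {x y P : ℝ} (hy0 : 0 ≤ y) (hyx : y ≤ x) (hxP : x ≤ P) (hP : P ≤ 1) :
    P * √(y / x) + (1 - P) * √((1 - y) / (1 - x)) ≤ √(x * y) + √((1 - x) * (1 - y)) := by
  -- for `x = 0` and for `x = 1` the ratio with denominator `0` contributes `0` to the left side
  rcases (hy0.trans hyx).eq_or_lt with h0 | h0
  · obtain rfl : x = 0 := h0.symm
    obtain rfl : y = 0 := le_antisymm hyx hy0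
    simp [hxP]
  rcases (hxP.trans hP).eq_or_lt with h1 | h1
  · have : P = 1 := by linarith
    subst this
    simp [h1]
  have h2 : √(y / x) ≤ 1 := Real.sqrt_le_one.2 (div_le_one_of_le₀ hyx h0.le)
  have h3 : 1 ≤ √((1 - y) / (1 - x)) :=
    Real.one_le_sqrt.2 ((one_le_div (by linarith)).2 (by linarith))
  rw [← mul_sqrt_div h0, ← mul_sqrt_div (by linarith : 0 < 1 - x)]
  nlinarith

lemma sqrt_ratio_le_exp {x y P : ℝ} (hx0 : 0 ≤ x) (hx1 : x ≤ 1) (hy0 : 0 ≤ y) (hy1 : y ≤ 1)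
    (hP0 : 0 ≤ P) (hP1 : P ≤ 1) (h : x = y ∨ (y ≤ x ∧ x ≤ P) ∨ (P ≤ x ∧ x ≤ y)) :
    ∑ b, bern P b * √(bern y b / bern x b) ≤ Real.exp (-((√x - √y) ^ 2 / 2)) := by
  simp only [Fintype.sum_bool, bern, if_true, Bool.false_eq_true, if_false]
  rcases h with rfl | ⟨h1, h2⟩ | ⟨h1, h2⟩
  · have a1 : √(x / x) ≤ 1 := Real.sqrt_le_one.2 (div_self_le_one x)
    have a2 : √((1 - x) / (1 - x)) ≤ 1 := Real.sqrt_le_one.2 (div_self_le_one _)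
    simp only [sub_self, ne_eq, OfNat.ofNat_ne_zero, not_false_eq_true, zero_pow, zero_div,
      neg_zero, Real.exp_zero]
    nlinarith
  · exact (sqrt_ratio_le_affinity hy0 h1 h2 hP1).trans (affinity_le_exp hx0 hx1 hy0 hy1)
  · refine le_trans ?_ (affinity_le_exp hx0 hx1 hy0 hy1)
    -- exchange the roles of success and failure
    have := sqrt_ratio_le_affinity (x := 1 - x) (y := 1 - y) (P := 1 - P) (by linarith)
      (by linarith) (by linarith) (by linarith)
    simp only [sub_sub_cancel] at this
    linarith

/-- **Chernoff bound for likelihood comparison.** Independent Bernoulli variables have success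
probabilities `P e`; the product likelihood with parameters `y` beats the one with parameters `x`
with the stated probability, if `P e` lies beyond `x e` as seen from `y e` wherever `x e ≠ y e`.
The hypotheses `h0` and `h1` say that the likelihood with parameters `x` is almost surely
positive. -/
lemma prob_likelihood_le {ι : Type*} [Fintype ι] [DecidableEq ι] {x y P : ι → ℝ}
    (hx0 : ∀ e, 0 ≤ x e) (hx1 : ∀ e, x e ≤ 1) (hy0 : ∀ e, 0 ≤ y e) (hy1 : ∀ e, y e ≤ 1)
    (hP0 : ∀ e, 0 ≤ P e) (hP1 : ∀ e, P e ≤ 1)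
    (h0 : ∀ e, 0 < P e → 0 < x e) (h1 : ∀ e, P e < 1 → x e < 1)
    (h : ∀ e, x e = y e ∨ (y e ≤ x e ∧ x e ≤ P e) ∨ (P e ≤ x e ∧ x e ≤ y e)) :
    ∑ ω : ι → Bool, (if ∏ e, bern (x e) (ω e) ≤ ∏ e, bern (y e) (ω e)
        then ∏ e, bern (P e) (ω e) else 0)
      ≤ Real.exp (-((∑ e, (√(x e) - √(y e)) ^ 2) / 2)) := by
  have hprod : ∀ ω : ι → Bool, (if ∏ e, bern (x e) (ω e) ≤ ∏ e, bern (y e) (ω e)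
        then ∏ e, bern (P e) (ω e) else 0)
      ≤ ∏ e, bern (P e) (ω e) * √(bern (y e) (ω e) / bern (x e) (ω e)) := by
    intro ω
    have hP : ∀ e, 0 ≤ bern (P e) (ω e) := fun e => bern_nonneg (hP0 e) (hP1 e) _
    split_ifs with hle
    swap
    · exact Finset.prod_nonneg fun e _ => mul_nonneg (hP e) (Real.sqrt_nonneg _)
    rcases (Finset.prod_nonneg fun e _ => hP e : 0 ≤ ∏ e, bern (P e) (ω e)).eq_or_lt with hz | hz
    · rw [← hz]
      exact Finset.prod_nonneg fun e _ => mul_nonneg (hP e) (Real.sqrt_nonneg _)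
    have hpos : ∀ e, 0 < bern (x e) (ω e) := by
      intro e
      have hne : bern (P e) (ω e) ≠ 0 := (Finset.prod_ne_zero_iff.1 hz.ne') e (Finset.mem_univ e)
      have hlt := lt_of_le_of_ne (hP e) hne.symm
      revert hlt
      cases ω e
      · simpa [bern] using h1 e
      · simpa [bern] using h0 e
    rw [Finset.prod_mul_distrib]
    refine le_mul_of_one_le_right hz.le ?_
    have hX : 0 < ∏ e, bern (x e) (ω e) := Finset.prod_pos fun e _ => hpos e
    rw [← Real.sqrt_prod _ fun e _ => div_nonneg (bern_nonneg (hy0 e) (hy1 e) _) (hpos e).le,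
      Finset.prod_div_distrib]
    exact Real.one_le_sqrt.2 ((one_le_div hX).2 hle)
  calc _ ≤ ∑ ω : ι → Bool, ∏ e, bern (P e) (ω e) * √(bern (y e) (ω e) / bern (x e) (ω e)) :=
        Finset.sum_le_sum fun ω _ => hprod ω
    _ = ∏ e, ∑ b, bern (P e) b * √(bern (y e) b / bern (x e) b) := by
        rw [Finset.prod_univ_sum, Fintype.piFinset_univ]
    _ ≤ ∏ e, Real.exp (-((√(x e) - √(y e)) ^ 2 / 2)) :=
        Finset.prod_le_prod
          (fun e _ => Finset.sum_nonneg fun b _ =>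
            mul_nonneg (bern_nonneg (hP0 e) (hP1 e) b) (Real.sqrt_nonneg _))
          fun e _ => sqrt_ratio_le_exp (hx0 e) (hx1 e) (hy0 e) (hy1 e) (hP0 e) (hP1 e) (h e)
    _ = _ := by rw [← Real.exp_sum, Finset.sum_neg_distrib, Finset.sum_div]

lemma edgeLaw_real_singleton {n : ℕ} (P : Matrix (Fin n) (Fin n) unitInterval)
    (ω : Pair n → Bool) :
    (edgeLaw P).real {ω} = ∏ e : Pair n, bern (P e.1.1 e.1.2) (ω e) := by
  rw [edgeLaw, measureReal_def, Measure.pi_singleton, ENNReal.toReal_prod]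
  refine Finset.prod_congr rfl fun e _ => ?_
  rw [← measureReal_def]
  cases ω e <;> simp [bern]

lemma integral_edgeLaw {n : ℕ} (P : Matrix (Fin n) (Fin n) unitInterval)
    (f : (Pair n → Bool) → ℝ) :
    ∫ ω, f ω ∂(edgeLaw P) = ∑ ω, (∏ e : Pair n, bern (P e.1.1 e.1.2) (ω e)) * f ω := by
  have : IsFiniteMeasure (edgeLaw P) := by unfold edgeLaw; infer_instance
  rw [integral_fintype Integrable.of_finite]
  simp [edgeLaw_real_singleton]

lemma sum_prod_bern {ι : Type*} [Fintype ι] [DecidableEq ι] (P : ι → ℝ) :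
    ∑ ω : ι → Bool, ∏ e, bern (P e) (ω e) = 1 := by
  have := Finset.prod_univ_sum (fun _ : ι => (Finset.univ : Finset Bool))
    (fun e b => bern (P e) b)
  rw [Fintype.piFinset_univ] at this
  rw [← this]
  simp [bern]

lemma likelihood_adjacency {n k : ℕ} (θ : Fin n → ℝ) (p q : ℝ) (ω : Pair n → Bool)
    (z : Fin n → Fin k) :
    likelihood θ p q (adjacency ω) z = ∏ e : Pair n,
      bern (θ e.1.1 * θ e.1.2 * if z e.1.1 = z e.1.2 then p else q) (ω e) := by
  refine Finset.prod_congr rfl fun e _ => ?_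
  have : adjacency ω e.1.1 e.1.2 = (ω e).toNat := by simp [adjacency, e.2]
  simp only [this]
  split_ifs <;> cases ω e <;> simp [bern]

/-! ### Discordance of two labelings -/

/-- The total weight of the unordered pairs of distinct nodes on which `z` and `s` disagree as to
whether the two nodes share a community; a pair `{i, j}` weighs `θ i * θ j`. -/
noncomputable def discordance {n k : ℕ} (θ : Fin n → ℝ) (z s : Fin n → Fin k) : ℝ :=
  ∑ e : Pair n, if (z e.1.1 = z e.1.2 ↔ s e.1.1 = s e.1.2) then 0 else θ e.1.1 * θ e.1.2

/-- The total weight of the community `u` of `z`. -/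
noncomputable def mass {n k : ℕ} (θ : Fin n → ℝ) (z : Fin n → Fin k) (u : Fin k) : ℝ :=
  ∑ i, if z i = u then θ i else 0

/-- The total weight of the nodes to which `z` and `s` give different labels. -/
noncomputable def errorMass {n k : ℕ} (θ : Fin n → ℝ) (z s : Fin n → Fin k) : ℝ :=
  ∑ i, if s i = z i then 0 else θ i

lemma sum_sum_eq_two_mul_sum_pair {n : ℕ} (f : Fin n → Fin n → ℝ) (hs : ∀ i j, f i j = f j i)
    (hd : ∀ i, f i i = 0) : ∑ i, ∑ j, f i j = 2 * ∑ e : Pair n, f e.1.1 e.1.2 := by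
  have h1 : ∑ e : Pair n, f e.1.1 e.1.2 = ∑ i, ∑ j, if i < j then f i j else 0 := by
    rw [← Fintype.sum_prod_type' (f := fun i j => if i < j then f i j else 0),
      ← Finset.sum_filter]
    exact (Finset.sum_subtype _ (by simp) (fun x : Fin n × Fin n => f x.1 x.2)).symm
  have h2 : ∑ e : Pair n, f e.1.1 e.1.2 = ∑ i, ∑ j, if j < i then f i j else 0 := by
    rw [h1, Finset.sum_comm]
    simp only [hs]
  rw [two_mul]
  nth_rewrite 1 [h1]
  rw [h2]
  simp only [← Finset.sum_add_distrib]
  refine Finset.sum_congr rfl fun i _ => Finset.sum_congr rfl fun j _ => ?_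
  rcases lt_trichotomy i j with h | rfl | h
  · simp [h, h.not_gt]
  · simp [hd]
  · simp [h, h.not_gt]

lemma two_mul_discordance {n k : ℕ} (θ : Fin n → ℝ) (z s : Fin n → Fin k) :
    2 * discordance θ z s =
      ∑ i, ∑ j, if (z i = z j ↔ s i = s j) then 0 else θ i * θ j := by
  rw [discordance, sum_sum_eq_two_mul_sum_pair
    (fun i j => if (z i = z j ↔ s i = s j) then 0 else θ i * θ j)]
  · intro i j
    simp only [eq_comm (a := z j), eq_comm (a := s j), mul_comm]
  · simp

lemma discordance_perm {n k : ℕ} (θ : Fin n → ℝ) (z s : Fin n → Fin k)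
    (π : Equiv.Perm (Fin k)) : discordance θ (π ∘ z) s = discordance θ z s := by
  simp [discordance]

lemma mass_perm {n k : ℕ} (θ : Fin n → ℝ) (z : Fin n → Fin k) (π : Equiv.Perm (Fin k))
    (u : Fin k) : mass θ (π ∘ z) u = mass θ z (π.symm u) := by
  simp [mass, Equiv.eq_symm_apply]

/-- A misplaced node disagrees with the correctly placed nodes of two communities, the one it left
and the one it entered. -/
lemma errorMass_mul_le_discordance {n k : ℕ} {θ : Fin n → ℝ} (hθ : ∀ i, 0 ≤ θ i)
    (z s : Fin n → Fin k) {L : ℝ} (hL : ∀ u v, u ≠ v → L ≤ mass θ z u + mass θ z v) :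
    errorMass θ z s * (L - errorMass θ z s) ≤ discordance θ z s := by
  set F : Fin n → Fin n → ℝ := fun i j => if (z i = z j ↔ s i = s j) then 0 else θ i * θ j with hF
  have hF0 : ∀ i j, 0 ≤ F i j := by
    intro i j
    simp only [hF]
    split_ifs
    exacts [le_rfl, mul_nonneg (hθ i) (hθ j)]
  have hFs : ∀ i j, F i j = F j i := by
    intro i j
    simp only [hF, eq_comm (a := z j), eq_comm (a := s j), mul_comm]
  -- keep only the pairs of a misplaced node `i` and a correctly placed node `j`
  set G : Fin n → Fin n → ℝ := fun i j => if s i ≠ z i ∧ s j = z j then F i j else 0 with hG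
  have h1 : ∑ i, ∑ j, G i j + ∑ i, ∑ j, G j i ≤ 2 * discordance θ z s := by
    rw [two_mul_discordance, ← Finset.sum_add_distrib]
    refine Finset.sum_le_sum fun i _ => ?_
    rw [← Finset.sum_add_distrib]
    refine Finset.sum_le_sum fun j _ => ?_
    change G i j + G j i ≤ F i j
    have := hF0 i j
    simp only [hG, hFs j i]
    by_cases h1 : s i = z i <;> by_cases h2 : s j = z j <;> simp [h1, h2, this]
  have h2 : ∑ i, ∑ j, G j i = ∑ i, ∑ j, G i j := Finset.sum_comm
  have h3 : errorMass θ z s * (L - errorMass θ z s) ≤ ∑ i, ∑ j, G i j := by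
    nth_rewrite 1 [errorMass]
    rw [Finset.sum_mul]
    refine Finset.sum_le_sum fun i _ => ?_
    by_cases hi : s i = z i
    · simp [hi, hG]
    rw [if_neg hi]
    have h4 : mass θ z (z i) + mass θ z (s i) - errorMass θ z s
        ≤ ∑ j, if s j = z j ∧ (z j = z i ∨ z j = s i) then θ j else 0 := by
      rw [mass, mass, errorMass, ← Finset.sum_add_distrib, ← Finset.sum_sub_distrib]
      refine Finset.sum_le_sum fun j _ => ?_
      have := hθ j
      grind
    have h5 : ∑ j, G i j
        = θ i * ∑ j, if s j = z j ∧ (z j = z i ∨ z j = s i) then θ j else 0 := by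
      rw [Finset.mul_sum]
      refine Finset.sum_congr rfl fun j _ => ?_
      simp only [hG, hF, hi, ne_eq, not_false_eq_true, true_and]
      by_cases a : s j = z j
      · simp only [a, true_and, if_true]
        grind
      · simp [a]
    rw [h5]
    exact mul_le_mul_of_nonneg_left
      (by linarith [hL (z i) (s i) (Ne.symm hi)]) (hθ i)
  linarith

/-- The total weight of the nodes in community `u` of `z` and in community `v` of `s`. -/
noncomputable def overlap {n k : ℕ} (θ : Fin n → ℝ) (z s : Fin n → Fin k) (u v : Fin k) : ℝ :=
  ∑ i, if z i = u ∧ s i = v then θ i else 0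

lemma two_mul_discordance_eq_overlap {n k : ℕ} (θ : Fin n → ℝ) (z s : Fin n → Fin k) :
    2 * discordance θ z s =
      ∑ i, θ i * (mass θ z (z i) + mass θ s (s i) - 2 * overlap θ z s (z i) (s i)) := by
  rw [two_mul_discordance]
  refine Finset.sum_congr rfl fun i _ => ?_
  rw [mass, mass, overlap, Finset.mul_sum, ← Finset.sum_add_distrib, ← Finset.sum_sub_distrib,
    Finset.mul_sum]
  refine Finset.sum_congr rfl fun j _ => ?_
  simp only [eq_comm (a := z i), eq_comm (a := s i)]
  by_cases a : z j = z i <;> by_cases b : s j = s i <;> grind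

lemma overlap_le_left {n k : ℕ} {θ : Fin n → ℝ} (hθ : ∀ i, 0 ≤ θ i) (z s : Fin n → Fin k)
    (u v : Fin k) : overlap θ z s u v ≤ mass θ z u := by
  refine Finset.sum_le_sum fun i _ => ?_
  have := hθ i
  by_cases a : z i = u <;> by_cases b : s i = v <;> simp [a, b, this]

lemma overlap_comm {n k : ℕ} (θ : Fin n → ℝ) (z s : Fin n → Fin k) (u v : Fin k) :
    overlap θ z s u v = overlap θ s z v u := by
  simp only [overlap, and_comm]

lemma overlap_add_le {n k : ℕ} {θ : Fin n → ℝ} (hθ : ∀ i, 0 ≤ θ i) (z s : Fin n → Fin k)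
    (u : Fin k) {v v' : Fin k} (hv : v ≠ v') :
    overlap θ z s u v + overlap θ z s u v' ≤ mass θ z u := by
  rw [overlap, overlap, ← Finset.sum_add_distrib]
  refine Finset.sum_le_sum fun i _ => ?_
  have := hθ i
  grind

/-- Call `u` and `v` linked if the overlap of `u` and `v` is more than half of each community.
Being linked is a partial matching of labels. Each node outside the linked overlaps takes part in
discordances of weight at least half of a community. -/
lemma exists_perm_errorMass_le_discordance {n k : ℕ} {θ : Fin n → ℝ} (hθ : ∀ i, 0 ≤ θ i)
    (z s : Fin n → Fin k) {α : ℝ} (hz : ∀ u, α ≤ mass θ z u)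
    (hs : ∀ u, α ≤ mass θ s u) :
    ∃ π : Equiv.Perm (Fin k), α / 4 * errorMass θ (π ∘ z) s ≤ discordance θ z s := by
  classical
  set R : Fin k → Fin k → Prop := fun u v =>
    mass θ z u < 2 * overlap θ z s u v ∧ mass θ s v < 2 * overlap θ z s u v with hR
  have hR1 : ∀ u v v', R u v → R u v' → v = v' := by
    intro u v v' h h'
    by_contra hne
    have := overlap_add_le hθ z s u hne
    linarith [h.1, h'.1]
  have hR2 : ∀ u u' v, R u v → R u' v → u = u' := by
    intro u u' v h h'
    by_contra hne
    have := overlap_add_le hθ s z v hne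
    rw [overlap_comm θ s z, overlap_comm θ s z] at this
    linarith [h.2, h'.2]
  -- extend the partial matching to a permutation `π`
  set f : Fin k → Fin k := fun u => if h : ∃ v, R u v then h.choose else u with hf
  have hfR : ∀ u, (∃ v, R u v) → R u (f u) := by
    intro u h
    simp only [hf, dif_pos h]
    exact h.choose_spec
  obtain ⟨g, hg⟩ := Finset.exists_equiv_extend_of_card_eq (α := Fin k) (β := Fin k)
    (t := Finset.univ) (by simp) (s := Finset.univ.filter fun u => ∃ v, R u v) (f := f)
    (by simp) (by
      intro u hu u' hu' he
      have h1 := hfR u (by simpa using hu)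
      have h2 := hfR u' (by simpa using hu')
      rw [← he] at h2
      exact hR2 _ _ _ h1 h2)
  set π : Equiv.Perm (Fin k) := g.trans (Equiv.subtypeUnivEquiv (by simp)) with hπ
  have hπR : ∀ u v, R u v → v = π u := by
    intro u v h
    have h1 : (g u : Fin k) = f u := hg u (by simpa using ⟨v, h⟩)
    have h2 : π u = g u := rfl
    rw [h2, h1]
    exact hR1 u v _ h (hfR u ⟨v, h⟩)
  refine ⟨π, ?_⟩
  have key : α / 2 * errorMass θ (π ∘ z) s ≤ 2 * discordance θ z s := by
    rw [two_mul_discordance_eq_overlap, errorMass, Finset.mul_sum]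
    refine Finset.sum_le_sum fun i _ => ?_
    have h1 := overlap_le_left hθ z s (z i) (s i)
    have h2 := overlap_le_left hθ s z (s i) (z i)
    rw [overlap_comm θ s z] at h2
    split_ifs with h
    · rw [mul_zero]
      exact mul_nonneg (hθ i) (by linarith)
    · have hn : ¬ R (z i) (s i) := fun hr => h (hπR _ _ hr)
      rw [mul_comm]
      refine mul_le_mul_of_nonneg_left ?_ (hθ i)
      simp only [hR, not_and_or, not_lt] at hn
      rcases hn with hn | hn
      · linarith [hz (z i)]
      · linarith [hs (s i)]
  linarith

/-! ### Union bound over labelings -/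

lemma sum_prod_ite_le {n k : ℕ} (z : Fin n → Fin k) {a : Fin n → ℝ} (ha : ∀ i, 0 ≤ a i) :
    ∑ s : Fin n → Fin k, ∏ i, (if s i = z i then 1 else a i) ≤ Real.exp (k * ∑ i, a i) := by
  have h := Finset.prod_univ_sum (fun _ : Fin n => (Finset.univ : Finset (Fin k)))
    (fun i v => if v = z i then (1 : ℝ) else a i)
  rw [Fintype.piFinset_univ] at h
  rw [← h, Finset.mul_sum, Real.exp_sum]
  refine Finset.prod_le_prod (fun i _ => Finset.sum_nonneg fun v _ => ?_) fun i _ => ?_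
  · split_ifs
    exacts [zero_le_one, ha i]
  · calc ∑ v, (if v = z i then (1 : ℝ) else a i)
        ≤ ∑ v, ((if v = z i then (1 : ℝ) else 0) + a i) := by
          refine Finset.sum_le_sum fun v _ => ?_
          have := ha i
          split_ifs <;> linarith
      _ = k * a i + 1 := by
          rw [Finset.sum_add_distrib]
          simp
          ring
      _ ≤ _ := Real.add_one_le_exp _

lemma exp_hammingDist {n k : ℕ} (s z : Fin n → Fin k) :
    Real.exp (hammingDist s z) = ∏ i, if s i = z i then 1 else Real.exp 1 := by
  rw [hammingDist, Finset.card_filter]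
  push_cast
  rw [Real.exp_sum]
  refine Finset.prod_congr rfl fun i _ => ?_
  by_cases h : s i = z i <;> simp [h]

/-- A union bound over all labelings for the expected number of errors. The exponential moment of
the number of errors factorizes over the nodes, and the tangent line of `exp` at `c` turns it into a
bound on the mean. The bound is useful also where the sum of all the probabilities is large. -/
lemma sum_mul_hammingDist_le {Ω : Type*} [Fintype Ω] {n k : ℕ} {W : Ω → ℝ}
    (hW : ∀ ω, 0 ≤ W ω) (hW1 : ∑ ω, W ω = 1) (z : Fin n → Fin k) (σ : Ω → Fin n → Fin k)
    {a b : Fin n → ℝ} (ha : ∀ i, 0 ≤ a i) (hb : ∀ i, 0 ≤ b i) {ε : ℝ} (hε : 0 ≤ ε)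
    (h : ∀ s, ∑ ω, (if σ ω = s then W ω else 0) ≤
      (∏ i, if s i = z i then 1 else a i) + ε * ∏ i, if s i = z i then 1 else b i) :
    ∑ ω, W ω * hammingDist (σ ω) z ≤ Real.exp 1 * k * ∑ i, a i +
      ε * Real.exp (Real.exp 1 * k * ∑ i, b i) := by
  set c := Real.exp 1 * k * ∑ i, a i with hc
  have hc0 : 0 ≤ c := by
    have : 0 ≤ ∑ i, a i := Finset.sum_nonneg fun i _ => ha i
    positivity
  have hmgf : ∑ ω, W ω * Real.exp (hammingDist (σ ω) z) ≤
      Real.exp c + ε * Real.exp (Real.exp 1 * k * ∑ i, b i) := by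
    have hmul : ∀ (d : Fin n → ℝ) (s : Fin n → Fin k),
        Real.exp (hammingDist s z) * ∏ i, (if s i = z i then 1 else d i) =
          ∏ i, if s i = z i then 1 else Real.exp 1 * d i := by
      intro d s
      rw [exp_hammingDist, ← Finset.prod_mul_distrib]
      refine Finset.prod_congr rfl fun i _ => ?_
      split_ifs <;> simp
    have hsum : ∀ d : Fin n → ℝ, (∀ i, 0 ≤ d i) →
        ∑ s : Fin n → Fin k, ∏ i, (if s i = z i then 1 else Real.exp 1 * d i) ≤
          Real.exp (Real.exp 1 * k * ∑ i, d i) := by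
      intro d hd
      have := sum_prod_ite_le z (a := fun i => Real.exp 1 * d i)
        fun i => mul_nonneg (Real.exp_pos 1).le (hd i)
      rwa [← Finset.mul_sum, ← mul_assoc, mul_comm (k : ℝ)] at this
    calc ∑ ω, W ω * Real.exp (hammingDist (σ ω) z)
        = ∑ ω, ∑ s, (if σ ω = s then Real.exp (hammingDist s z) * W ω else 0) := by
          refine Finset.sum_congr rfl fun ω _ => ?_
          simp [mul_comm]
      _ = ∑ s, Real.exp (hammingDist s z) * ∑ ω, (if σ ω = s then W ω else 0) := by
          rw [Finset.sum_comm]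
          simp only [Finset.mul_sum, mul_ite, mul_zero]
      _ ≤ ∑ s : Fin n → Fin k, ((∏ i, if s i = z i then 1 else Real.exp 1 * a i) +
            ε * ∏ i, if s i = z i then 1 else Real.exp 1 * b i) := by
          refine Finset.sum_le_sum fun s _ => ?_
          rw [← hmul, ← hmul]
          have := mul_le_mul_of_nonneg_left (h s) (Real.exp_pos (hammingDist s z)).le
          linarith
      _ ≤ _ := by
          rw [Finset.sum_add_distrib, ← Finset.mul_sum]
          exact add_le_add (hsum a ha) (mul_le_mul_of_nonneg_left (hsum b hb) hε)
  have htangent : ∀ ω, W ω * hammingDist (σ ω) z ≤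
      W ω * (c - 1) + Real.exp (-c) * (W ω * Real.exp (hammingDist (σ ω) z)) := by
    intro ω
    have := Real.add_one_le_exp ((hammingDist (σ ω) z : ℝ) - c)
    rw [sub_eq_add_neg, Real.exp_add] at this
    have := mul_le_mul_of_nonneg_left this (hW ω)
    linarith
  calc ∑ ω, W ω * (hammingDist (σ ω) z : ℝ)
      ≤ ∑ ω, (W ω * (c - 1) + Real.exp (-c) * (W ω * Real.exp (hammingDist (σ ω) z))) :=
        Finset.sum_le_sum fun ω _ => htangent ω
    _ = c - 1 + Real.exp (-c) * ∑ ω, W ω * Real.exp (hammingDist (σ ω) z) := by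
        rw [Finset.sum_add_distrib, ← Finset.sum_mul, ← Finset.mul_sum, hW1, one_mul]
    _ ≤ c - 1 + Real.exp (-c) * (Real.exp c + ε * Real.exp (Real.exp 1 * k * ∑ i, b i)) := by
        gcongr
    _ = c + Real.exp (-c) * (ε * Real.exp (Real.exp 1 * k * ∑ i, b i)) := by
        rw [mul_add, ← Real.exp_add, neg_add_cancel, Real.exp_zero]
        ring
    _ ≤ c + 1 * (ε * Real.exp (Real.exp 1 * k * ∑ i, b i)) := by
        gcongr
        exact Real.exp_le_one_iff.2 (by linarith)
    _ = _ := by rw [one_mul]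

lemma exp_neg_mul_errorMass {n k : ℕ} (θ : Fin n → ℝ) (z s : Fin n → Fin k) (t : ℝ) :
    Real.exp (-(t * errorMass θ z s)) =
      ∏ i, if s i = z i then 1 else Real.exp (-(t * θ i)) := by
  rw [errorMass, Finset.mul_sum, ← Finset.sum_neg_distrib, Real.exp_sum]
  refine Finset.prod_congr rfl fun i _ => ?_
  split_ifs <;> simp

/-! ### Admissible labelings -/

section ParameterSpace

variable {n k : ℕ} {θ : Fin n → ℝ} {p q β δ : ℝ} {P : Matrix (Fin n) (Fin n) unitInterval}
  {z s : Fin n → Fin k}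

lemma mul_mul_le_one (hθ : ∀ i, 0 < θ i) (hs : s ∈ admissible k θ p q β δ) {i j : Fin n}
    (hij : i ≠ j) (h : s i = s j) : θ i * θ j * p ≤ 1 := by
  obtain ⟨P, B, hP⟩ := hs
  have h1 := hP.prob i j hij
  rw [h] at h1
  calc θ i * θ j * p ≤ θ i * θ j * B (s j) (s j) :=
        mul_le_mul_of_nonneg_left (hP.within _) (mul_pos (hθ i) (hθ j)).le
    _ = P i j := h1.symm
    _ ≤ 1 := (P i j).2.2

/-- The probability that the likelihood of an admissible labeling reaches that of the truth. -/
lemma prob_likelihood_le_exp_discordance (hθ : ∀ i, 0 < θ i) (hq0 : 0 ≤ q)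
    (hq1 : ∀ i j, i ≠ j → θ i * θ j * q < 1) (hP : HasLabels θ p q β δ P z)
    (hs : s ∈ admissible k θ p q β δ) :
    ∑ ω : Pair n → Bool, (if likelihood θ p q (adjacency ω) z ≤ likelihood θ p q (adjacency ω) s
        then ∏ e : Pair n, bern (P e.1.1 e.1.2) (ω e) else 0)
      ≤ Real.exp (-((√p - √q) ^ 2 / 2 * discordance θ z s)) := by
  have hz : z ∈ admissible k θ p q β δ := ⟨P, hP⟩
  obtain ⟨B, hB⟩ := hP
  have hp0 : 0 < p := hq0.trans_lt hB.lt
  have hr : ∀ e : Pair n, 0 < θ e.1.1 * θ e.1.2 := fun e => mul_pos (hθ _) (hθ _)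
  have hne : ∀ e : Pair n, e.1.1 ≠ e.1.2 := fun e => e.2.ne
  have hin : ∀ e : Pair n, z e.1.1 = z e.1.2 → θ e.1.1 * θ e.1.2 * p ≤ P e.1.1 e.1.2 := by
    intro e he
    rw [hB.prob _ _ (hne e), he]
    exact mul_le_mul_of_nonneg_left (hB.within _) (hr e).le
  have hout : ∀ e : Pair n, z e.1.1 ≠ z e.1.2 →
      (P e.1.1 e.1.2 : ℝ) ≤ θ e.1.1 * θ e.1.2 * q := by
    intro e he
    rw [hB.prob _ _ (hne e)]
    exact mul_le_mul_of_nonneg_left (hB.between _ _ he) (hr e).le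
  have h0 : ∀ (t : Fin n → Fin k) (e : Pair n),
      0 ≤ θ e.1.1 * θ e.1.2 * if t e.1.1 = t e.1.2 then p else q := by
    intro t e
    refine mul_nonneg (hr e).le ?_
    split_ifs
    exacts [hp0.le, hq0]
  have h1 : ∀ t ∈ admissible k θ p q β δ, ∀ e : Pair n,
      (θ e.1.1 * θ e.1.2 * if t e.1.1 = t e.1.2 then p else q) ≤ 1 := by
    intro t ht e
    split_ifs with h
    exacts [mul_mul_le_one hθ ht (hne e) h, (hq1 _ _ (hne e)).le]
  have key := prob_likelihood_le (ι := Pair n)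
    (x := fun e => θ e.1.1 * θ e.1.2 * if z e.1.1 = z e.1.2 then p else q)
    (y := fun e => θ e.1.1 * θ e.1.2 * if s e.1.1 = s e.1.2 then p else q)
    (P := fun e => P e.1.1 e.1.2) (h0 z) (h1 z hz) (h0 s) (h1 s hs)
    (fun e => (P e.1.1 e.1.2).2.1) (fun e => (P e.1.1 e.1.2).2.2)
    (fun e he => by
      split_ifs with h
      · exact mul_pos (hr e) hp0
      · exact he.trans_le (hout e h))
    (fun e he => by
      split_ifs with h
      · exact (hin e h).trans_lt he
      · exact hq1 _ _ (hne e))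
    (fun e => by
      have hqp := mul_le_mul_of_nonneg_left hB.lt.le (hr e).le
      by_cases h : z e.1.1 = z e.1.2 <;> by_cases h' : s e.1.1 = s e.1.2 <;>
        simp only [h, h', if_true, if_false]
      · exact Or.inl trivial
      · exact Or.inr (Or.inl ⟨hqp, hin e h⟩)
      · exact Or.inr (Or.inr ⟨hout e h, hqp⟩)
      · exact Or.inl trivial)
  simp only [likelihood_adjacency]
  refine key.trans (le_of_eq ?_)
  congr 2
  rw [discordance, Finset.mul_sum, Finset.sum_div]
  refine Finset.sum_congr rfl fun e _ => ?_
  have hsq : ∀ a b : ℝ, (√(θ e.1.1 * θ e.1.2 * a) - √(θ e.1.1 * θ e.1.2 * b)) ^ 2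
      = θ e.1.1 * θ e.1.2 * (√a - √b) ^ 2 := by
    intro a b
    rw [Real.sqrt_mul (hr e).le, Real.sqrt_mul (hr e).le, ← mul_sub, mul_pow,
      Real.sq_sqrt (hr e).le]
  rw [hsq]
  by_cases h : z e.1.1 = z e.1.2 <;> by_cases h' : s e.1.1 = s e.1.2 <;> simp [h, h'] <;> ring

lemma mass_add_mass {u v : Fin k} (huv : u ≠ v) (h : ∀ w, w = u ∨ w = v) :
    mass θ z u + mass θ z v = ∑ i, θ i := by
  rw [mass, mass, ← Finset.sum_add_distrib]
  refine Finset.sum_congr rfl fun i _ => ?_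
  rcases h (z i) with hi | hi <;> simp [hi, huv, huv.symm]

lemma commSize_eq_mass (u : Fin k) : (commSize z u : ℝ) = mass 1 z u := by
  simp [commSize, mass]

/-- The factor of `θ i * (√p - √q) ^ 2` in the exponents that define `info`. Up to rounding, it is
a lower bound for half of the number of nodes in the union of two communities; for `k = 2` this
union contains all nodes, and the value does not depend on `β`. -/
noncomputable def effSize (n k : ℕ) (β : ℝ) : ℝ :=
  if k = 2 then (n : ℝ) / 2 else (n : ℝ) / (β * k)

lemma div_le_effSize (hβ : 1 ≤ β) : (n : ℝ) / (β * k) ≤ effSize n k β := by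
  unfold effSize
  split_ifs with h
  · subst h
    push_cast
    exact div_le_div_of_nonneg_left (by positivity) two_pos (by linarith)
  · exact le_rfl

lemma effSize_le_mul_div (hβ : 1 ≤ β) : effSize n k β ≤ β * (n / (β * k)) := by
  have hb : 0 < β := by linarith
  unfold effSize
  split_ifs with h
  · subst h
    apply le_of_eq
    push_cast
    field_simp
  · exact le_mul_of_one_le_left (by positivity) hβ

lemma le_mass (hP : HasLabels θ p q β δ P z) (hn : 1 < (n : ℝ) / (β * k))
    (u : Fin k) : (1 - δ) * commSize z u ≤ mass θ z u := by
  obtain ⟨B, hB⟩ := hP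
  have h1 := (hB.normalization u).1
  rw [Finset.sum_filter] at h1
  have h2 : 0 < (commSize z u : ℝ) := by linarith [hB.size_lower u]
  exact (le_div_iff₀ h2).1 h1

lemma sum_le_of_hasLabels (hP : HasLabels θ p q β δ P z) (hn : 1 < (n : ℝ) / (β * k)) :
    ∑ i, θ i ≤ (1 + δ) * n := by
  obtain ⟨B, hB⟩ := hP
  have h1 : ∀ u, mass θ z u ≤ (1 + δ) * mass 1 z u := by
    intro u
    have h1 := (hB.normalization u).2
    rw [Finset.sum_filter] at h1
    have h2 : 0 < (commSize z u : ℝ) := by linarith [hB.size_lower u]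
    rw [← commSize_eq_mass]
    exact (div_le_iff₀ h2).1 h1
  have h2 : ∀ θ : Fin n → ℝ, ∑ i, θ i = ∑ u, mass θ z u := by
    intro θ
    simp only [mass]
    rw [Finset.sum_comm]
    simp
  calc ∑ i, θ i = ∑ u, mass θ z u := h2 θ
    _ ≤ ∑ u, (1 + δ) * mass 1 z u := Finset.sum_le_sum fun u _ => h1 u
    _ = (1 + δ) * ∑ i, (1 : Fin n → ℝ) i := by rw [← Finset.mul_sum, h2]
    _ = (1 + δ) * n := by simp

lemma le_mass_add_mass (hP : HasLabels θ p q β δ P z) (hδ : δ ≤ 1)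
    (hn : 1 < (n : ℝ) / (β * k)) {u v : Fin k} (huv : u ≠ v) :
    2 * ((1 - δ) * (effSize n k β - 1)) ≤ mass θ z u + mass θ z v := by
  have h1 := le_mass hP hn
  have key : 2 * (effSize n k β - 1) ≤ commSize z u + commSize z v := by
    unfold effSize
    split_ifs with h
    · subst h
      have h2 : ∀ w, w = u ∨ w = v := by omega
      rw [commSize_eq_mass, commSize_eq_mass, mass_add_mass huv h2]
      simp
      linarith
    · obtain ⟨B, hB⟩ := hP
      linarith [hB.size_lower u, hB.size_lower v]
  have := mul_le_mul_of_nonneg_left key (sub_nonneg.2 hδ)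
  linarith [h1 u, h1 v]

end ParameterSpace

/-! ### Risk of the maximum likelihood estimator -/

section ParameterSpace

variable {n k : ℕ} {θ : Fin n → ℝ} {p q β δ : ℝ} {P : Matrix (Fin n) (Fin n) unitInterval}
  {z s : Fin n → Fin k}

/-- After a suitable relabeling of `z`, the error probability splits into the rate-optimal product
over the misplaced nodes, which covers the labelings with small error mass, and a product with a
worse exponent but an additional tiny factor, which covers the labelings with large error mass. -/
lemma exists_perm_exp_discordance_le (hβ : 1 ≤ β) (hθ : ∀ i, 0 < θ i)
    (hz : z ∈ admissible k θ p q β δ) (hs : s ∈ admissible k θ p q β δ) {η : ℝ} (hη0 : 0 < η)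
    (hη1 : η ≤ 1) (hδ : δ ≤ η / 4) (hM1 : 4 / η ≤ effSize n k β) (hM2 : 2 * β ≤ effSize n k β)
    {D : ℝ} (hD : 0 ≤ D) :
    ∃ π : Equiv.Perm (Fin k), Real.exp (-(D / 2 * discordance θ z s)) ≤
      (∏ i, if s i = π (z i) then 1 else
        Real.exp (-((1 - η) * (effSize n k β * D) * θ i))) +
      Real.exp (-(η * effSize n k β * (effSize n k β * D) / (64 * β))) *
        ∏ i, if s i = π (z i) then 1 else
          Real.exp (-(effSize n k β * D / (64 * β) * θ i)) := by
  set M := effSize n k β with hM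
  have hβ0 : 0 < β := by linarith
  have hM0 : 0 < M := by linarith
  have hn : M / β ≤ (n : ℝ) / (β * k) := by
    rw [div_le_iff₀ hβ0, mul_comm]
    exact effSize_le_mul_div hβ
  have hMβ : 2 ≤ M / β := (le_div_iff₀ hβ0).2 hM2
  have hn1 : 1 < (n : ℝ) / (β * k) := by linarith
  have hmass : ∀ t ∈ admissible k θ p q β δ, ∀ u, M / (4 * β) ≤ mass θ t u := by
    rintro t ⟨P, hP⟩ u
    have h1 := le_mass hP hn1 u
    obtain ⟨B, hB⟩ := hP
    have h2 := hB.size_lower u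
    have h3 : M / (4 * β) = M / β / 4 := by field_simp
    nlinarith
  have hθ' : ∀ i, 0 ≤ θ i := fun i => (hθ i).le
  obtain ⟨π, hπ⟩ := exists_perm_errorMass_le_discordance hθ' z s (hmass z hz) (hmass s hs)
  have hL : ∀ u v, u ≠ v → (2 - η) * M ≤ mass θ (π ∘ z) u + mass θ (π ∘ z) v := by
    intro u v huv
    rw [mass_perm, mass_perm]
    obtain ⟨P, hP⟩ := hz
    have h1 := le_mass_add_mass hP (by linarith) hn1 (π.symm.injective.ne huv)
    rw [← hM] at h1
    have h2 : 4 ≤ M * η := (div_le_iff₀ hη0).1 hM1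
    have h3 : (1 - η / 4) * (M - 1) ≤ (1 - δ) * (M - 1) :=
      mul_le_mul_of_nonneg_right (by linarith) (by linarith)
    linarith
  have hsmall := errorMass_mul_le_discordance hθ' (π ∘ z) s hL
  rw [discordance_perm] at hsmall
  set g := errorMass θ (π ∘ z) s with hg
  have hg0 : 0 ≤ g := by
    refine Finset.sum_nonneg fun i _ => ?_
    split_ifs
    exacts [le_rfl, hθ' i]
  have hD2 : 0 ≤ D / 2 := by linarith
  refine ⟨π, ?_⟩
  have e1 := exp_neg_mul_errorMass θ (π ∘ z) s ((1 - η) * (M * D))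
  have e2 := exp_neg_mul_errorMass θ (π ∘ z) s (M * D / (64 * β))
  simp only [Function.comp_apply] at e1 e2
  rw [← e1, ← e2, ← hg, ← Real.exp_add]
  -- the first summand bounds the left side if `g` is at most `η * M`, the second one otherwise
  rcases le_total g (η * M) with h | h
  · refine le_trans (Real.exp_le_exp.2 ?_) (le_add_of_nonneg_right (Real.exp_pos _).le)
    have h1 : g * (2 * (1 - η) * M) ≤ discordance θ z s :=
      le_trans (mul_le_mul_of_nonneg_left (by linarith) hg0) hsmall
    have := mul_le_mul_of_nonneg_left h1 hD2
    linarith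
  · refine le_trans (Real.exp_le_exp.2 ?_) (le_add_of_nonneg_left (Real.exp_pos _).le)
    have h1 := mul_le_mul_of_nonneg_left hπ hD2
    -- half of the exponent remains proportional to `g`, the other half uses `g ≥ η * M`
    have h2 : D / 2 * (M / (4 * β) / 4 * g) = M * D / (64 * β) * g + M * D / (64 * β) * g := by
      field_simp
      ring
    have h3 : M * D / (64 * β) * (η * M) ≤ M * D / (64 * β) * g :=
      mul_le_mul_of_nonneg_left h (by positivity)
    have h4 : η * M * (M * D) / (64 * β) = M * D / (64 * β) * (η * M) := by ring
    linarith

lemma loss_le (s z : Fin n → Fin k) (π : Equiv.Perm (Fin k)) :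
    loss s z ≤ (1 / (n : ℝ)) * hammingDist s (π ∘ z) := by
  unfold loss
  gcongr
  exact ciInf_le ⟨0, by rintro _ ⟨π, rfl⟩; positivity⟩ π

lemma likelihood_perm (ω : Pair n → Bool) (π : Equiv.Perm (Fin k)) :
    likelihood θ p q (adjacency ω) (π ∘ z) = likelihood θ p q (adjacency ω) z := by
  simp [likelihood]

/-- The union bound applied to the estimator, with the labelings of error mass at most, and at
least, `η * effSize n k β` in the first, and the second, summand. -/
lemma risk_le (hβ : 1 ≤ β) (hθ : ∀ i, 0 < θ i) (hq0 : 0 ≤ q)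
    (hq1 : ∀ i j, i ≠ j → θ i * θ j * q < 1) (hP : HasLabels θ p q β δ P z)
    {zhat : Matrix (Fin n) (Fin n) ℕ → Fin n → Fin k} (hzhat : IsMLE θ p q β δ zhat)
    {η : ℝ} (hη0 : 0 < η) (hη1 : η ≤ 1) (hδ : δ ≤ η / 4) (hM1 : 4 / η ≤ effSize n k β)
    (hM2 : 2 * β ≤ effSize n k β) :
    risk zhat P z ≤ (1 / (n : ℝ)) * (Real.exp 1 * k *
        ∑ i, Real.exp (-((1 - η) * (effSize n k β * (√p - √q) ^ 2) * θ i)) +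
      Real.exp (-(η * effSize n k β * (effSize n k β * (√p - √q) ^ 2) / (64 * β))) *
        Real.exp (Real.exp 1 * k *
          ∑ i, Real.exp (-(effSize n k β * (√p - √q) ^ 2 / (64 * β) * θ i)))) := by
  have hz : z ∈ admissible k θ p q β δ := ⟨P, hP⟩
  have hmle := hzhat ⟨z, hz⟩
  choose π hπ using fun (s : Fin n → Fin k) (hs : s ∈ admissible k θ p q β δ) =>
    exists_perm_exp_discordance_le hβ hθ hz hs hη0 hη1 hδ hM1 hM2 (sq_nonneg (√p - √q))
  set τ : (Pair n → Bool) → Equiv.Perm (Fin k) :=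
    fun ω => π (zhat (adjacency ω)) (hmle ω).1 with hτ
  -- the estimate, relabeled so as to be compared with `z` itself
  set σ : (Pair n → Bool) → Fin n → Fin k :=
    fun ω => (τ ω).symm ∘ zhat (adjacency ω) with hσ
  have hhat : ∀ ω, zhat (adjacency ω) = τ ω ∘ σ ω := by
    intro ω
    ext i
    simp [hσ]
  have hW : ∀ ω : Pair n → Bool, 0 ≤ ∏ e : Pair n, bern (P e.1.1 e.1.2) (ω e) := fun ω =>
    Finset.prod_nonneg fun e _ => bern_nonneg (P e.1.1 e.1.2).2.1 (P e.1.1 e.1.2).2.2 _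
  have key := sum_mul_hammingDist_le hW (sum_prod_bern fun e : Pair n => (P e.1.1 e.1.2 : ℝ)) z σ
    (a := fun i => Real.exp (-((1 - η) * (effSize n k β * (√p - √q) ^ 2) * θ i)))
    (b := fun i => Real.exp (-(effSize n k β * (√p - √q) ^ 2 / (64 * β) * θ i)))
    (fun i => (Real.exp_pos _).le) (fun i => (Real.exp_pos _).le)
    (ε := Real.exp (-(η * effSize n k β * (effSize n k β * (√p - √q) ^ 2) / (64 * β))))
    (Real.exp_pos _).le (by
      intro s
      by_cases hex : ∃ ω₀, σ ω₀ = s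
      · obtain ⟨ω₀, rfl⟩ := hex
        have h1 := prob_likelihood_le_exp_discordance hθ hq0 hq1 hP (hmle ω₀).1
        have h2 := hπ _ (hmle ω₀).1
        have h3 : ∀ i, (zhat (adjacency ω₀) i = π _ (hmle ω₀).1 (z i) ↔ σ ω₀ i = z i) := by
          intro i
          simp only [hσ, hτ, Function.comp_apply]
          exact (Equiv.symm_apply_eq _).symm
        simp only [h3] at h2
        refine le_trans (le_trans (Finset.sum_le_sum fun ω _ => ?_) h1) h2
        by_cases hω : σ ω = σ ω₀
        · have h4 := (hmle ω).2 z hz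
          have h5 : likelihood θ p q (adjacency ω) (zhat (adjacency ω₀)) =
              likelihood θ p q (adjacency ω) (σ ω₀) :=
            (congrArg _ (hhat ω₀)).trans (likelihood_perm ω _)
          rw [hhat ω, likelihood_perm, hω, ← h5] at h4
          rw [if_pos hω, if_pos h4]
        · rw [if_neg hω]
          split_ifs
          exacts [hW ω, le_rfl]
      · push Not at hex
        simp only [hex, if_false, Finset.sum_const_zero]
        refine add_nonneg (Finset.prod_nonneg fun i _ => ?_)
          (mul_nonneg (Real.exp_pos _).le (Finset.prod_nonneg fun i _ => ?_)) <;>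
        split_ifs <;> positivity)
  refine le_trans ?_ (mul_le_mul_of_nonneg_left key (by positivity))
  rw [risk, integral_edgeLaw, Finset.mul_sum]
  refine Finset.sum_le_sum fun ω _ => ?_
  have h1 := loss_le (zhat (adjacency ω)) z (τ ω)
  have h2 : hammingDist (zhat (adjacency ω)) (τ ω ∘ z) = hammingDist (σ ω) z := by
    rw [hhat ω]
    exact hammingDist_comp (fun _ => τ ω) fun _ => (τ ω).injective
  rw [h2] at h1
  calc _ ≤ _ := mul_le_mul_of_nonneg_left h1 (hW ω)
    _ = _ := by ring

end ParameterSpace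

/-! ### The information `I` -/

lemma exp_neg_info {n k : ℕ} (hn : 0 < n) (θ : Fin n → ℝ) (p q β : ℝ) :
    Real.exp (-info k θ p q β) =
      (1 / (n : ℝ)) * ∑ i, Real.exp (-(effSize n k β * (√p - √q) ^ 2 * θ i)) := by
  have : Nonempty (Fin n) := ⟨⟨0, hn⟩⟩
  have hpos : ∀ f : Fin n → ℝ, 0 < (1 / (n : ℝ)) * ∑ i, Real.exp (f i) := fun f => by
    have : 0 < ∑ i, Real.exp (f i) :=
      Finset.sum_pos (fun i _ => Real.exp_pos _) Finset.univ_nonempty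
    positivity
  rw [info, neg_neg, Real.exp_log]
  · unfold effSize
    split_ifs <;>
      refine congrArg _ (Finset.sum_congr rfl fun i _ => congrArg Real.exp ?_) <;> ring
  · split_ifs <;> exact hpos _

/-- Jensen's inequality for the concave function `x ↦ x ^ t`. -/
lemma sum_exp_le {n : ℕ} (hn : 0 < n) (f : Fin n → ℝ) {t : ℝ} (ht0 : 0 ≤ t) (ht1 : t ≤ 1) :
    (1 / (n : ℝ)) * ∑ i, Real.exp (-(t * f i)) ≤
      ((1 / (n : ℝ)) * ∑ i, Real.exp (-f i)) ^ t := by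
  have h := (Real.concaveOn_rpow ht0 ht1).le_map_sum (t := Finset.univ)
    (w := fun _ : Fin n => 1 / (n : ℝ)) (p := fun i => Real.exp (-f i))
    (fun _ _ => by positivity) (by simp [hn.ne']) (fun i _ => (Real.exp_pos _).le)
  simp only [smul_eq_mul, ← Finset.mul_sum, ← Real.exp_mul] at h
  simpa only [neg_mul, mul_comm t] using h

lemma sum_exp_le_info {n k : ℕ} (hn : 0 < n) (θ : Fin n → ℝ) (p q β : ℝ) {t : ℝ} (ht0 : 0 ≤ t)
    (ht1 : t ≤ 1) :
    (1 / (n : ℝ)) * ∑ i, Real.exp (-(t * (effSize n k β * (√p - √q) ^ 2) * θ i)) ≤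
      Real.exp (-(t * info k θ p q β)) := by
  have h := sum_exp_le hn (fun i => effSize n k β * (√p - √q) ^ 2 * θ i) ht0 ht1
  rw [← exp_neg_info hn, ← Real.exp_mul] at h
  simp only [← mul_assoc] at h ⊢
  convert h using 2
  ring

/-- Jensen's inequality for the exponential function. -/
lemma info_le {n k : ℕ} (hn : 0 < n) (θ : Fin n → ℝ) (p q β : ℝ) :
    info k θ p q β ≤ effSize n k β * (√p - √q) ^ 2 * ((1 / (n : ℝ)) * ∑ i, θ i) := by
  have h := convexOn_exp.map_sum_le (t := Finset.univ)
    (w := fun _ : Fin n => 1 / (n : ℝ)) (p := fun i => -(effSize n k β * (√p - √q) ^ 2 * θ i))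
    (fun _ _ => by positivity) (by simp [hn.ne']) (fun i _ => Set.mem_univ _)
  simp only [smul_eq_mul, ← Finset.mul_sum] at h
  rw [← exp_neg_info hn, Real.exp_le_exp, Finset.sum_neg_distrib, ← Finset.mul_sum] at h
  linarith

/-- The risk bound in terms of the information. The hypotheses on `effSize n k β`, `k` and
`info k θ p q β` hold for all large `n` if the effective size and the information tend to infinity
and `log k` is of smaller order than the information. -/
lemma risk_le_exp_info {n k : ℕ} {θ : Fin n → ℝ} {p q β δ : ℝ}
    {P : Matrix (Fin n) (Fin n) unitInterval} {z : Fin n → Fin k} (hn : 0 < n) (hk : 0 < k)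
    (hβ : 1 ≤ β) (hθ : ∀ i, 0 < θ i) (hq0 : 0 ≤ q)
    (hq1 : ∀ i j, i ≠ j → θ i * θ j * q < 1) (hP : HasLabels θ p q β δ P z)
    {zhat : Matrix (Fin n) (Fin n) ℕ → Fin n → Fin k} (hzhat : IsMLE θ p q β δ zhat)
    {η : ℝ} (hη0 : 0 < η) (hη1 : η ≤ 1) (hδ : δ ≤ η / 4) (hM1 : 4 / η ≤ effSize n k β)
    (hM2 : 2 * β ≤ effSize n k β) (hM3 : 256 * β ≤ η * effSize n k β)
    (hk1 : Real.log k ≤ η * info k θ p q β)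
    (hk2 : Real.log k ≤ 1 / (128 * β) * info k θ p q β)
    (hI1 : Real.log 4 ≤ η * info k θ p q β)
    (hI2 : Real.exp 1 * β ≤ η / (256 * β) * info k θ p q β) :
    risk zhat P z ≤ Real.exp (-((1 - 3 * η) * info k θ p q β)) := by
  have h := risk_le hβ hθ hq0 hq1 hP hzhat hη0 hη1 hδ hM1 hM2
  have hs1 := sum_exp_le_info (k := k) hn θ p q β (t := 1 - η) (by linarith) (by linarith)
  have hβ0 : 0 < β := by linarith
  have hs2 := sum_exp_le_info (k := k) hn θ p q β (t := 1 / (64 * β)) (by positivity)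
    (by rw [div_le_one (by positivity)]; linarith)
  have hIle := info_le (k := k) hn θ p q β
  set I := info k θ p q β with hI
  set M := effSize n k β with hM
  set y := M * (√p - √q) ^ 2 with hy
  have hn0 : (0 : ℝ) < n := by exact_mod_cast hn
  have hn1 : (1 : ℝ) ≤ n := by exact_mod_cast hn
  have hk0 : (0 : ℝ) < k := by exact_mod_cast hk
  have hM0 : 0 < M := by linarith
  have hI0 : 0 < I := by
    have : 0 < η * I := (Real.log_pos (by norm_num)).trans_le hI1
    exact pos_of_mul_pos_right this hη0.le
  have hnk : M / β ≤ (n : ℝ) / (β * k) := by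
    rw [div_le_iff₀ hβ0, mul_comm]
    exact effSize_le_mul_div hβ
  have hMβ : 2 ≤ M / β := (le_div_iff₀ hβ0).2 hM2
  have hsum := sum_le_of_hasLabels hP (by linarith)
  have hy0 : 0 ≤ y := by positivity
  have hIy : I ≤ 2 * y := by
    have h1 : (1 / (n : ℝ)) * ∑ i, θ i ≤ 2 := by
      rw [one_div, inv_mul_le_iff₀ hn0]
      linarith [mul_le_mul_of_nonneg_right (by linarith : 1 + δ ≤ 2) hn0.le]
    linarith [mul_le_mul_of_nonneg_left h1 hy0]
  -- the labelings with small error mass: the factor `k` costs `exp (η * I)`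
  have hpart1 : (1 / (n : ℝ)) * (Real.exp 1 * k * ∑ i, Real.exp (-((1 - η) * y * θ i))) ≤
      Real.exp 1 * Real.exp (-((1 - 2 * η) * I)) := by
    have h1 : (k : ℝ) ≤ Real.exp (η * I) := (Real.log_le_iff_le_exp hk0).1 hk1
    calc _ = Real.exp 1 * (k * ((1 / (n : ℝ)) * ∑ i, Real.exp (-((1 - η) * y * θ i)))) := by ring
      _ ≤ Real.exp 1 * (Real.exp (η * I) * Real.exp (-((1 - η) * I))) := by gcongr
      _ = _ := by
        rw [← Real.exp_add]
        ring_nf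
  -- the labelings with large error mass
  have hpart2 : (1 / (n : ℝ)) * (Real.exp (-(η * M * y / (64 * β))) *
      Real.exp (Real.exp 1 * k * ∑ i, Real.exp (-(y / (64 * β) * θ i)))) ≤
      Real.exp (-((1 - 2 * η) * I)) := by
    have h1 : (k : ℝ) ≤ Real.exp (1 / (128 * β) * I) := (Real.log_le_iff_le_exp hk0).1 hk2
    have h2 : ∑ i, Real.exp (-(y / (64 * β) * θ i)) ≤
        n * Real.exp (-(1 / (64 * β) * I)) := by
      rw [one_div, inv_mul_le_iff₀ hn0] at hs2
      refine le_trans (le_of_eq ?_) hs2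
      refine Finset.sum_congr rfl fun i _ => ?_
      ring_nf
    have h3 : (n : ℝ) ≤ β * k * M := by
      have := div_le_effSize (n := n) (k := k) hβ
      rw [div_le_iff₀ (by positivity)] at this
      linarith
    -- `k` enters twice, through the labels and through `n ≤ β * k * M`, and both factors are
    -- absorbed by `exp (-I / (64 * β))`
    have h4 : Real.exp 1 * k * ∑ i, Real.exp (-(y / (64 * β) * θ i)) ≤
        M * (η / (256 * β) * I) := by
      calc _ ≤ Real.exp 1 * k * ((β * k * M) * Real.exp (-(1 / (64 * β) * I))) := by
            have := h2.trans (mul_le_mul_of_nonneg_right h3 (Real.exp_pos _).le)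
            gcongr
        _ = M * (Real.exp 1 * β * (k * k * Real.exp (-(1 / (64 * β) * I)))) := by ring
        _ ≤ M * (Real.exp 1 * β * (Real.exp (1 / (128 * β) * I) * Real.exp (1 / (128 * β) * I)
              * Real.exp (-(1 / (64 * β) * I)))) := by gcongr
        _ = M * (Real.exp 1 * β) := by
            have : 1 / (128 * β) * I + 1 / (128 * β) * I + -(1 / (64 * β) * I) = 0 := by
              field_simp
              ring
            rw [← Real.exp_add, ← Real.exp_add, this, Real.exp_zero, mul_one]
        _ ≤ _ := by gcongr
    have h5 : M * (η / (128 * β) * I) ≤ η * M * y / (64 * β) := by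
      have : η * M * y / (64 * β) = M * (η / (128 * β) * (2 * y)) := by
        field_simp
        ring
      rw [this]
      gcongr
    have h6 : I ≤ M * (η / (256 * β) * I) := by
      have : M * (η / (256 * β) * I) = (η * M) / (256 * β) * I := by ring
      rw [this]
      exact le_mul_of_one_le_left hI0.le ((one_le_div (by positivity)).2 hM3)
    have h7 : M * (η / (128 * β) * I) = 2 * (M * (η / (256 * β) * I)) := by
      field_simp
      ring
    rw [← Real.exp_add]
    refine (mul_le_of_le_one_left (Real.exp_pos _).le ((div_le_one hn0).2 hn1)).trans ?_
    refine Real.exp_le_exp.2 ?_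
    linarith [mul_pos hη0 hI0]
  have he : Real.exp 1 ≤ 3 := by linarith [Real.exp_one_lt_d9]
  have h4 : (4 : ℝ) ≤ Real.exp (η * I) := (Real.log_le_iff_le_exp (by norm_num)).1 hI1
  calc risk zhat P z ≤ _ := h
    _ ≤ Real.exp 1 * Real.exp (-((1 - 2 * η) * I)) + Real.exp (-((1 - 2 * η) * I)) := by
        rw [mul_add]
        exact add_le_add hpart1 hpart2
    _ ≤ Real.exp (η * I) * Real.exp (-((1 - 2 * η) * I)) := by
        linarith [mul_le_mul_of_nonneg_right (by linarith : Real.exp 1 + 1 ≤ Real.exp (η * I))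
          (Real.exp_pos (-((1 - 2 * η) * I))).le]
    _ = _ := by
        rw [← Real.exp_add]
        ring_nf

end DCBM

/-! ### The asymptotic bound -/

theorem mainTheorem1
    (k : ℕ → ℕ) (θ : (n : ℕ) → Fin n → ℝ) (p q δ : ℕ → ℝ) (β : ℝ)
    (hk : ∀ n, 2 ≤ k n)
    (hβ : 1 ≤ β)
    (hδ : Tendsto δ atTop (𝓝 0))
    (hpq : ∀ᶠ n in atTop, 0 ≤ q n ∧ q n < p n)
    (hq : ∀ᶠ n in atTop, ∀ i j, i ≠ j → θ n i * θ n j * q n < 1)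
    (hI : Tendsto (fun n => DCBM.info (k n) (θ n) (p n) (q n) β) atTop atTop)
    (hθmax : (fun n => ‖θ n‖) =o[atTop] fun n => (n : ℝ) / (k n : ℝ))
    (hθmin : ∃ c : ℝ, 0 < c ∧ ∀ n i, c ≤ θ n i)
    (hlogk : (fun n => Real.log (k n)) =o[atTop]
      fun n => min (DCBM.info (k n) (θ n) (p n) (q n) β) (Real.log n))
    (hβ3 : ∀ᶠ n in atTop, 3 ≤ k n → β < √(5 / 3))
    (zhat : (n : ℕ) → Matrix (Fin n) (Fin n) ℕ → Fin n → Fin (k n))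
    (hzhat : ∀ n, DCBM.IsMLE (θ n) (p n) (q n) β (δ n) (zhat n)) :
    limsup (fun n =>
        ENNReal.log (DCBM.worstRisk (θ n) (p n) (q n) β (δ n) (zhat n)) /
          ((DCBM.info (k n) (θ n) (p n) (q n) β : ℝ) : EReal)) atTop
      ≤ (-1 : EReal) := by
  obtain ⟨c, hc0, hc⟩ := hθmin
  have hβ0 : 0 < β := by linarith
  -- the communities grow, because `‖θ n‖` is bounded from below and of smaller order than `n / k n`
  have hsize : ∀ K : ℝ, ∀ᶠ n in atTop, K ≤ DCBM.effSize n (k n) β := by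
    intro K
    have hε : 0 < c / (β * (|K| + 1)) := by positivity
    filter_upwards [hθmax.bound hε, eventually_gt_atTop 0] with n h1 h2
    have h3 : c ≤ ‖θ n‖ :=
      (hc n ⟨0, h2⟩).trans ((le_abs_self _).trans (norm_le_pi_norm (θ n) ⟨0, h2⟩))
    rw [norm_norm, Real.norm_of_nonneg (by positivity)] at h1
    have h4 := DCBM.div_le_effSize (n := n) (k := k n) hβ
    have h5 : c ≤ c * ((n : ℝ) / (β * k n) / (|K| + 1)) :=
      (h3.trans h1).trans (le_of_eq (by field_simp))
    have h6 := (le_div_iff₀ (by positivity)).1 (one_le_of_le_mul_left₀ hc0 h5)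
    linarith [le_abs_self K]
  refine EReal.le_of_forall_lt_iff_le.1 fun r hr => ?_
  have hr' : -1 < r :=
    EReal.coe_lt_coe_iff.1 (by rwa [EReal.coe_neg, EReal.coe_one])
  obtain ⟨η, hη0, hη1, hηr⟩ : ∃ η : ℝ, 0 < η ∧ η ≤ 1 ∧ -(1 - 3 * η) ≤ r :=
    ⟨min ((r + 1) / 3) 1, lt_min (by linarith) one_pos, min_le_right _ _,
      by linarith [min_le_left ((r + 1) / 3) 1]⟩
  have hlog : ∀ ε : ℝ, 0 < ε → ∀ᶠ n in atTop, Real.log (k n) ≤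
      ε * DCBM.info (k n) (θ n) (p n) (q n) β := by
    intro ε hε
    filter_upwards [hlogk.bound hε, hI.eventually_ge_atTop 0, eventually_gt_atTop 0]
      with n h1 h2 h3
    have h4 : 0 ≤ Real.log n := Real.log_natCast_nonneg n
    rw [Real.norm_of_nonneg (le_min h2 h4)] at h1
    exact (le_abs_self _).trans (h1.trans (mul_le_mul_of_nonneg_left (min_le_left _ _) hε.le))
  refine limsup_le_of_le (by isBoundedDefault) ?_
  filter_upwards [eventually_gt_atTop 0, hpq, hq,
    hδ.eventually_le_const (by positivity : (0 : ℝ) < η / 4), hsize (4 / η), hsize (2 * β),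
    hsize (256 * β / η), hlog η hη0, hlog (1 / (128 * β)) (by positivity),
    hI.eventually_ge_atTop (Real.log 4 / η),
    hI.eventually_ge_atTop (Real.exp 1 * β / (η / (256 * β))), hI.eventually_gt_atTop 0]
    with n hn hpqn hqn hδn hM1 hM2 hM3 hk1 hk2 hI1 hI2 hI0
  have hworst : DCBM.worstRisk (θ n) (p n) (q n) β (δ n) (zhat n) ≤
      ENNReal.ofReal (Real.exp (-((1 - 3 * η) * DCBM.info (k n) (θ n) (p n) (q n) β))) := by
    refine iSup_le fun P => iSup_le fun z => iSup_le fun hP => ENNReal.ofReal_le_ofReal ?_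
    exact DCBM.risk_le_exp_info hn (by linarith [hk n]) hβ (fun i => hc0.trans_le (hc n i))
      hpqn.1 hqn hP (hzhat n) hη0 hη1 hδn hM1 hM2 (by rwa [div_le_iff₀' hη0] at hM3) hk1 hk2
      (by rwa [div_le_iff₀' hη0] at hI1)
      (by rwa [div_le_iff₀' (by positivity)] at hI2)
  have hlogworst := ENNReal.log_monotone hworst
  rw [ENNReal.log_ofReal_of_pos (Real.exp_pos _), Real.log_exp] at hlogworst
  rw [EReal.div_le_iff_le_mul (by exact_mod_cast hI0) (EReal.coe_ne_top _)]
  refine hlogworst.trans ?_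
  rw [← EReal.coe_mul, EReal.coe_le_coe_iff]
  nlinarith
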